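/- Let $m\ge 2$ be even, let $\mathcal A=(a_{i_1\ldots i_m})$ and $\mathcal B=(b_{i_1\ldots i_m})$ be real tensors of order $m$ and dimension $n$, and let $\mathcal B$ be symmetric and positive definite, i.e. invariant under permutation of the indices with $\mathcal B x^m=\sum_{i_1,\ldots,i_m} b_{i_1\ldots i_m}x_{i_1}\cdots x_{i_m}>0$ for all $x\neq 0$. For $z=(x,t)\in\mathbb R^n\times\mathbb R=\mathbb R^{n+1}$ put $F(z)=(t^2\mathcal B-\mathcal A)x^{m-1}\in\mathbb R^n$, where $(\mathcal C x^{m-1})_i=\sum_{i_2,\ldots,i_m}c_{ii_2\ldots i_m}x_{i_2}\cdots x_{i_m}$, and for $\phi:\mathbb R^2\to\mathbb R$ put $$\Phi(z)=\big[\phi(x_i,F_i(z))\big]_{i=1}^n\in\mathbb R^n,\qquad H(z)=\begin{pmatrix}\Phi(z)\\ x^\top x-1\end{pmatrix}\in\mathbb R^{n+1}.$$ Let $H_{\min}$, $H_{FB}$ and $H_\tau$ ($0<\tau<1$) be the maps $H$ for $\phi_{\min}(a,b)=a-(a-b)_+$, $\phi_{FB}(a,b)=a+b-\sqrt{a^2+b^2}$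 and $\phi_\tau(a,b)=\tau\phi_{FB}(a,b)+(1-\tau)a_+b_+$, where $s_+=\max\{s,0\}$. For a locally Lipschitz $G:\mathbb R^{p}\to\mathbb R^{q}$, let $\partial G(y)\subseteq\mathbb R^{q\times p}$ be Clarke's generalized Jacobian, the convex hull of all limits of Jacobian matrices $JG(y^k)$ along sequences $y^k\to y$ of points at which $G$ is differentiable. $G$ is semismooth if it is locally Lipschitz and, for all $y,d\in\mathbb R^p$, the limit of $V\tilde d$ over $V\in\partial G(y+s\tilde d)$, $\tilde d\to d$, $s\downarrow0$, exists. $G$ is strongly semismooth if it is semismooth, its one-sided directional derivatives $G'(y;d)$ exist and, for every $y$, $Vd-G'(y;d)=O(\|d\|^2)$ as $d\to0$, uniformly over $V\in\partial G(y+d)$. **Theorem.** The maps $H_{\min}$, $H_{FB}$ and $H_\tau$ (for every $\tau\in(0,1)$) are strongly semismooth. Moreover, for each of these maps $H$, with corresponding $\Phi$, and for every $z=(x,t)\in\mathbb R^{n+1}$, $$\partial H(z)\subseteq\left\{\begin{pmatrix}V\\ 2x^\top\ \ 0\end{pmatrix}\in\mathbb R^{(n+1)\times(n+1)} : V\in\partial\Phi(z)\right\},$$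 and the same inclusion holds when $\phi$ is any locally Lipschitz NCP-function, i.e. a locally Lipschitz $\phi$ with $\phi(a,b)=0\iff ab=0,\ a\ge0,\ b\ge0$. -/

import Mathlib

open Filter Topology
open scoped Matrix

noncomputable section

namespace TEiCP

/-! ### Nonsmooth analysis -/

/-- `ℝⁿ` with the Euclidean norm. -/
abbrev Vec (n : ℕ) : Type := EuclideanSpace ℝ (Fin n)

/-- The usual `n₂ × n₁` Jacobian matrix of partial derivatives; only used at points of
differentiability. -/
def jacobian {n₁ n₂ : ℕ} (F : Vec n₁ → Vec n₂) (x : Vec n₁) : Matrix (Fin n₂) (Fin n₁) ℝ :=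
  Matrix.of fun i j => fderiv ℝ F x (EuclideanSpace.single j (1 : ℝ)) i

/-- The B-subdifferential: limits of Jacobians along sequences of points of differentiability
that converge to `x`. -/
def bSubdifferential {n₁ n₂ : ℕ} (F : Vec n₁ → Vec n₂) (x : Vec n₁) :
    Set (Matrix (Fin n₂) (Fin n₁) ℝ) :=
  {V | ∃ u : ℕ → Vec n₁, (∀ k, DifferentiableAt ℝ F (u k)) ∧ Tendsto u atTop (𝓝 x) ∧
    Tendsto (fun k => jacobian F (u k)) atTop (𝓝 V)}

/-- Clarke's generalized Jacobian: the convex hull of the B-subdifferential. -/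
def generalizedJacobian {n₁ n₂ : ℕ} (F : Vec n₁ → Vec n₂) (x : Vec n₁) :
    Set (Matrix (Fin n₂) (Fin n₁) ℝ) :=
  convexHull ℝ (bSubdifferential F x)

/-- The matrix-vector product `V d` as a Euclidean vector. -/
def mulVec {n₁ n₂ : ℕ} (V : Matrix (Fin n₂) (Fin n₁) ℝ) (d : Vec n₁) : Vec n₂ :=
  WithLp.toLp 2 (V *ᵥ d.ofLp)

/-- `F` is Lipschitz on a neighbourhood of `x`. -/
def LocallyLipschitzAt {n₁ n₂ : ℕ} (F : Vec n₁ → Vec n₂) (x : Vec n₁) : Prop :=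
  ∃ K : NNReal, ∃ s ∈ 𝓝 x, LipschitzOnWith K F s

/-- `F` is semismooth at `x`: it is locally Lipschitz at `x` and, for every `d`, the products
`V d'` with `V ∈ ∂F(x + t d')` converge to one limit `L` as `d' → d` and `t ↓ 0`. -/
def SemismoothAt {n₁ n₂ : ℕ} (F : Vec n₁ → Vec n₂) (x : Vec n₁) : Prop :=
  LocallyLipschitzAt F x ∧
    ∀ d : Vec n₁, ∃ L : Vec n₂, ∀ ε > (0 : ℝ),
      ∀ᶠ p : Vec n₁ × ℝ in 𝓝 d ×ˢ 𝓝[>] (0 : ℝ),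
        ∀ V ∈ generalizedJacobian F (x + p.2 • p.1), ‖mulVec V p.1 - L‖ < ε

/-- `L` is the one-sided directional derivative `F'(x; d)`. -/
def HasDirectionalDeriv {n₁ n₂ : ℕ} (F : Vec n₁ → Vec n₂) (x d : Vec n₁) (L : Vec n₂) : Prop :=
  Tendsto (fun t : ℝ => t⁻¹ • (F (x + t • d) - F x)) (𝓝[>] (0 : ℝ)) (𝓝 L)

/-- `F : ℝ^{n₁} → ℝ^{n₂}` is strongly semismooth: it is semismooth at every point and, for every
`x`, the directional derivatives at `x` exist and `V d - F'(x; d) = O(‖d‖²)` as `d → 0`,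
uniformly over `V ∈ ∂F(x + d)`. -/
def StronglySemismooth {n₁ n₂ : ℕ} (F : Vec n₁ → Vec n₂) : Prop :=
  (∀ x, SemismoothAt F x) ∧
    ∀ x, ∃ D : Vec n₁ → Vec n₂, (∀ d, HasDirectionalDeriv F x d (D d)) ∧
      ∃ C : ℝ, ∀ᶠ d in 𝓝 (0 : Vec n₁), ∀ V ∈ generalizedJacobian F (x + d),
        ‖mulVec V d - D d‖ ≤ C * ‖d‖ ^ 2

/-! ### Tensors -/

/-- Real tensors of order `m` and dimension `n`. -/
abbrev Tensor (m n : ℕ) : Type := (Fin m → Fin n) → ℝ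

/-- The vector `𝒜 x^{m-1}` of a tensor of order `m = k + 1`; its `i`th entry is
`∑ a_{i i₂ … iₘ} x_{i₂} ⋯ x_{iₘ}`. -/
def Tensor.applyVec {k n : ℕ} (A : Tensor (k + 1) n) (x : Fin n → ℝ) : Fin n → ℝ :=
  fun i => ∑ j : Fin k → Fin n, A (Fin.cons i j) * ∏ l, x (j l)

/-- The number `𝒜 x^m = xᵀ 𝒜 x^{m-1}`. -/
def Tensor.applyAll {k n : ℕ} (A : Tensor (k + 1) n) (x : Fin n → ℝ) : ℝ :=
  x ⬝ᵥ A.applyVec x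

/-- The entries are invariant under permutation of the indices. -/
def Tensor.IsSymmetric {m n : ℕ} (A : Tensor m n) : Prop :=
  ∀ (σ : Equiv.Perm (Fin m)) (j : Fin m → Fin n), A (j ∘ σ) = A j

/-- A symmetric tensor with `𝒜 x^m > 0` for all `x ≠ 0`. -/
def Tensor.IsPosDef {k n : ℕ} (A : Tensor (k + 1) n) : Prop :=
  A.IsSymmetric ∧ ∀ x : Fin n → ℝ, x ≠ 0 → 0 < A.applyAll x

/-! ### NCP-functions -/

/-- `φ(a, b) = 0` if and only if `a b = 0`, `a ≥ 0` and `b ≥ 0`. -/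
def IsNCPFunction (φ : ℝ → ℝ → ℝ) : Prop :=
  ∀ a b : ℝ, φ a b = 0 ↔ a * b = 0 ∧ 0 ≤ a ∧ 0 ≤ b

/-- The min function `a - (a - b)₊`. -/
def phiMin (a b : ℝ) : ℝ := a - max (a - b) 0

/-- The Fischer-Burmeister function. -/
def phiFB (a b : ℝ) : ℝ := (a + b) - √(a ^ 2 + b ^ 2)

/-- The penalized Fischer-Burmeister function. -/
def phiTau (τ a b : ℝ) : ℝ := τ * phiFB a b + (1 - τ) * (max a 0 * max b 0)

/-! ### The reformulation -/

/-- The part `x ∈ ℝⁿ` of `z = (x, t) ∈ ℝ^{n+1}`. -/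
def xPart {n : ℕ} (z : Vec (n + 1)) : Fin n → ℝ := fun i => z i.castSucc

/-- The part `t ∈ ℝ` of `z = (x, t) ∈ ℝ^{n+1}`. -/
def tPart {n : ℕ} (z : Vec (n + 1)) : ℝ := z (Fin.last n)

/-- `F(x, t) = (t² ℬ - 𝒜) x^{m-1}`. -/
def mapF {k n : ℕ} (A B : Tensor (k + 1) n) (x : Fin n → ℝ) (t : ℝ) : Fin n → ℝ :=
  Tensor.applyVec (t ^ 2 • B - A) x

/-- `Φ(z) = [φ(xᵢ, Fᵢ(x, t))]ᵢ`. -/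
def mapPhi {k n : ℕ} (φ : ℝ → ℝ → ℝ) (A B : Tensor (k + 1) n) (z : Vec (n + 1)) : Vec n :=
  WithLp.toLp 2 fun i => φ (xPart z i) (mapF A B (xPart z) (tPart z) i)

/-- `H(z) = (Φ(z), xᵀx - 1)`. -/
def mapH {k n : ℕ} (φ : ℝ → ℝ → ℝ) (A B : Tensor (k + 1) n) (z : Vec (n + 1)) : Vec (n + 1) :=
  WithLp.toLp 2 (Fin.snoc (α := fun _ => ℝ) (mapPhi φ A B z).ofLp (xPart z ⬝ᵥ xPart z - 1))

/-- The square matrix with first `n` rows `V` and last row `(2 xᵀ, 0)`. -/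
def bordered {n : ℕ} (V : Matrix (Fin n) (Fin (n + 1)) ℝ) (x : Fin n → ℝ) :
    Matrix (Fin (n + 1)) (Fin (n + 1)) ℝ :=
  Matrix.of (Fin.snoc (α := fun _ => Fin (n + 1) → ℝ) (fun i => V i)
    (Fin.snoc (α := fun _ => ℝ) (fun j => 2 * x j) 0))

end TEiCP

end

/-!
The inclusion is linear algebra: where `H` is differentiable so is `Φ`, and the Jacobian of `H` is
that of `Φ` bordered by the row `(2xᵀ, 0)` (`jacobian_mapH`). Bordering is affine in the matrix and
continuous in `x`, so the identity passes to limits and to convex hulls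
(`generalizedJacobian_mapH_subset`); nothing about `φ` is needed.

Strong semismoothness is not proved through Jacobians directly, because a composite may be
differentiable at points where its constituents are not, so that a condition on points of
differentiability is awkward to compose. Instead `HasStrongDirDeriv` asks for one-sided directional
derivatives `D y h` at *every* point, with `D y (y - x)` and `f y - f x` both equal to
`D x (y - x)` up to `O(‖y - x‖²)`. This property

* is stable under composition and pairing (`HasStrongDirDeriv.comp`, `HasStrongDirDeriv.prodMk`),
  hence under sums and products;
* holds for `C²` functions, and for locally Lipschitz positively homogeneous functions that are `C²`
  off the origin (`hasStrongDirDeriv_of_homogeneous`), such as `a ↦ max a 0` and the Euclidean norm.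

All three NCP-functions are built from these pieces, and `F` is polynomial, so `H` has the property.
Finally the property implies strong semismoothness
(`StrongDirDifferentiable.stronglySemismooth`): where the map is differentiable, `D y` is its
derivative, and the quadratic bound on `J(y)(y - x) - D x (y - x)` passes to limits of Jacobians
(`D x` is Lipschitz) and to convex combinations. Semismoothness follows since `D x` is positively
homogeneous and continuous.
-/

namespace TEiCP

open Asymptotics

/-! ### A calculus for strongly semismooth functions -/

section Calculus

variable {E F G : Type*} [NormedAddCommGroup E] [NormedSpace ℝ E] [NormedAddCommGroup F]
  [NormedSpace ℝ F] [NormedAddCommGroup G] [NormedSpace ℝ G]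

/-- `f` is locally Lipschitz, `D y h` is its one-sided directional derivative at `y` along `h`,
and near each point `x` both `D y (y - x)` and `f y - f x` agree with `D x (y - x)` up to
`O(‖y - x‖ ^ 2)`. In contrast to a condition on Jacobians at points of differentiability, this
notion is stable under composition. -/
structure HasStrongDirDeriv (f : E → F) (D : E → E → F) : Prop where
  locallyLipschitz : LocallyLipschitz f
  tendsto : ∀ y h, Tendsto (fun t : ℝ => t⁻¹ • (f (y + t • h) - f y)) (𝓝[>] (0 : ℝ)) (𝓝 (D y h))
  isBigO_dirDeriv : ∀ x, (fun y => D y (y - x) - D x (y - x)) =O[𝓝 x] fun y => ‖y - x‖ ^ 2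
  isBigO_sub : ∀ x, (fun y => f y - f x - D x (y - x)) =O[𝓝 x] fun y => ‖y - x‖ ^ 2

lemma tendsto_add_smul_nhdsGT (y h : E) :
    Tendsto (fun t : ℝ => y + t • h) (𝓝[>] (0 : ℝ)) (𝓝 y) := by
  have : Tendsto (fun t : ℝ => y + t • h) (𝓝 (0 : ℝ)) (𝓝 (y + (0 : ℝ) • h)) :=
    Continuous.tendsto (by fun_prop) 0
  simpa using this.mono_left nhdsWithin_le_nhds

lemma tendsto_slope_of_differentiableAt {f : E → F} {y : E} (hf : DifferentiableAt ℝ f y) (h : E) :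
    Tendsto (fun t : ℝ => t⁻¹ • (f (y + t • h) - f y)) (𝓝[>] (0 : ℝ)) (𝓝 (fderiv ℝ f y h)) :=
  (hf.hasFDerivAt.hasLineDerivAt h).tendsto_slope_zero_right

/-- The directional derivative inherits the Lipschitz constant of the function. -/
lemma norm_dirDeriv_sub_le {f : E → F} {K : NNReal} {s : Set E} (hf : LipschitzOnWith K f s)
    {y : E} (hs : s ∈ 𝓝 y) {h h' : E} {L L' : F}
    (hL : Tendsto (fun t : ℝ => t⁻¹ • (f (y + t • h) - f y)) (𝓝[>] (0 : ℝ)) (𝓝 L))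
    (hL' : Tendsto (fun t : ℝ => t⁻¹ • (f (y + t • h') - f y)) (𝓝[>] (0 : ℝ)) (𝓝 L')) :
    ‖L - L'‖ ≤ K * ‖h - h'‖ := by
  refine le_of_tendsto (hL.sub hL').norm ?_
  filter_upwards [self_mem_nhdsWithin, tendsto_add_smul_nhdsGT y h hs,
    tendsto_add_smul_nhdsGT y h' hs] with t ht h1 h2
  have ht : 0 < t := ht
  have := hf.norm_sub_le h1 h2
  rw [← smul_sub, norm_smul, sub_sub_sub_cancel_right, norm_inv, Real.norm_of_nonneg ht.le]
  rw [add_sub_add_left_eq_sub, ← smul_sub, norm_smul, Real.norm_of_nonneg ht.le] at this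
  rw [inv_mul_le_iff₀ ht]
  linarith

namespace HasStrongDirDeriv

lemma exists_lipschitz {f : E → F} {D : E → E → F} (hf : HasStrongDirDeriv f D) (x : E) :
    ∃ K : NNReal, ∀ᶠ y in 𝓝 x, ∀ h h', ‖D y h - D y h'‖ ≤ K * ‖h - h'‖ := by
  obtain ⟨K, s, hs, hK⟩ := hf.locallyLipschitz x
  refine ⟨K, ?_⟩
  filter_upwards [eventually_eventually_nhds.2 hs] with y hy h h'
  exact norm_dirDeriv_sub_le hK hy (hf.tendsto y h) (hf.tendsto y h')

lemma continuous {f : E → F} {D : E → E → F} (hf : HasStrongDirDeriv f D) (x : E) :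
    Continuous (D x) := by
  obtain ⟨K, hK⟩ := hf.exists_lipschitz x
  exact (LipschitzWith.of_dist_le_mul (K := K) fun a b => by
    simpa only [dist_eq_norm] using hK.self_of_nhds a b).continuous

lemma dirDeriv_smul {f : E → F} {D : E → E → F} (hf : HasStrongDirDeriv f D) (x h : E) {c : ℝ}
    (hc : 0 < c) : D x (c • h) = c • D x h := by
  have h0 : Tendsto (fun t : ℝ => t * c) (𝓝[>] 0) (𝓝[>] 0) := by
    refine tendsto_nhdsWithin_iff.2 ⟨?_, ?_⟩
    · have : Tendsto (fun t : ℝ => t * c) (𝓝 0) (𝓝 (0 * c)) := Continuous.tendsto (by fun_prop) 0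
      rw [zero_mul] at this
      exact this.mono_left nhdsWithin_le_nhds
    · filter_upwards [self_mem_nhdsWithin] with t ht
      exact mul_pos ht hc
  have h1 := ((hf.tendsto x h).comp h0).const_smul c
  refine tendsto_nhds_unique (hf.tendsto x (c • h)) (h1.congr fun t => ?_)
  simp only [Function.comp, smul_smul, mul_inv]
  congr 1
  field_simp

lemma eq_fderiv {f : E → F} {D : E → E → F} (hf : HasStrongDirDeriv f D) {y : E}
    (hy : DifferentiableAt ℝ f y) (h : E) : D y h = fderiv ℝ f y h :=
  tendsto_nhds_unique (hf.tendsto y h) (tendsto_slope_of_differentiableAt hy h)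

lemma comp {f : F → G} {g : E → F} {D : F → F → G} {D' : E → E → F}
    (hf : HasStrongDirDeriv f D) (hg : HasStrongDirDeriv g D') :
    HasStrongDirDeriv (fun x => f (g x)) fun y h => D (g y) (D' y h) := by
  have hcont := hg.locallyLipschitz.continuous
  have hgx (x : E) : (fun y => ‖g y - g x‖ ^ 2) =O[𝓝 x] fun y => ‖y - x‖ ^ 2 := by
    obtain ⟨K, s, hs, hK⟩ := hg.locallyLipschitz x
    have : (fun y => ‖g y - g x‖) =O[𝓝 x] fun y => ‖y - x‖ := by
      refine IsBigO.of_bound K ?_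
      filter_upwards [hs] with y hy
      simpa using hK.norm_sub_le hy (mem_of_mem_nhds hs)
    exact this.pow 2
  have hgE (x : E) := hg.isBigO_sub x
  -- `D (g y)` is Lipschitz, uniformly for `y` near `x`, so perturbations of the direction carry over
  have key (x : E) {u v : E → F} (huv : (fun y => u y - v y) =O[𝓝 x] fun y => ‖y - x‖ ^ 2) :
      (fun y => D (g y) (u y) - D (g y) (v y)) =O[𝓝 x] fun y => ‖y - x‖ ^ 2 := by
    obtain ⟨K, hK⟩ := hf.exists_lipschitz (g x)
    refine IsBigO.trans (IsBigO.of_bound K ?_) huv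
    filter_upwards [hcont.continuousAt.eventually hK] with y hy using hy _ _
  have key' (x : E) {u v : E → F} (huv : (fun y => u y - v y) =O[𝓝 x] fun y => ‖y - x‖ ^ 2) :
      (fun y => D (g x) (u y) - D (g x) (v y)) =O[𝓝 x] fun y => ‖y - x‖ ^ 2 := by
    obtain ⟨K, hK⟩ := hf.exists_lipschitz (g x)
    exact IsBigO.trans (IsBigO.of_bound K (.of_forall fun y => hK.self_of_nhds _ _)) huv
  refine ⟨hf.locallyLipschitz.comp hg.locallyLipschitz, fun y h => ?_, fun x => ?_, fun x => ?_⟩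
  · obtain ⟨K, s, hs, hK⟩ := hf.locallyLipschitz (g y)
    have h1 := hf.tendsto (g y) (D' y h)
    have h2 : Tendsto (fun t : ℝ => t⁻¹ • (f (g (y + t • h)) - f (g y + t • D' y h)))
        (𝓝[>] 0) (𝓝 0) := by
      have h3 : Tendsto (fun t : ℝ => K * ‖t⁻¹ • (g (y + t • h) - g y) - D' y h‖)
          (𝓝[>] 0) (𝓝 0) := by
        simpa using (((hg.tendsto y h).sub_const (D' y h)).norm).const_mul (K : ℝ)
      refine squeeze_zero_norm' ?_ h3
      filter_upwards [self_mem_nhdsWithin, tendsto_add_smul_nhdsGT (g y) (D' y h) hs,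
        (hcont.continuousAt.tendsto.comp (tendsto_add_smul_nhdsGT y h)) hs] with t ht m1 m2
      have ht : 0 < t := ht
      have h4 : t⁻¹ • (g (y + t • h) - g y) - D' y h
          = t⁻¹ • (g (y + t • h) - (g y + t • D' y h)) := by
        rw [← sub_sub, smul_sub t⁻¹ (_ - _), smul_smul, inv_mul_cancel₀ ht.ne', one_smul]
      rw [h4, norm_smul, norm_smul, mul_left_comm]
      exact mul_le_mul_of_nonneg_left (hK.norm_sub_le m2 m1) (norm_nonneg _)
    refine (zero_add (D (g y) (D' y h)) ▸ h2.add h1).congr fun t => ?_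
    rw [← smul_add, sub_add_sub_cancel]
  · have h1 : (fun y => D' y (y - x) - (g y - g x)) =O[𝓝 x] fun y => ‖y - x‖ ^ 2 :=
      ((hg.isBigO_dirDeriv x).sub (hgE x)).congr_left fun y => by abel
    have h2 := ((hf.isBigO_dirDeriv (g x)).comp_tendsto (hcont.tendsto x)).trans (hgx x)
    refine (((key x h1).add h2).add (key' x (hgE x))).congr_left fun y => ?_
    simp only [Function.comp]
    abel
  · have h2 := ((hf.isBigO_sub (g x)).comp_tendsto (hcont.tendsto x)).trans (hgx x)
    refine (h2.add (key' x (hgE x))).congr_left fun y => ?_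
    simp only [Function.comp]
    abel

lemma prodMk {f : E → F} {g : E → G} {D : E → E → F} {D' : E → E → G}
    (hf : HasStrongDirDeriv f D) (hg : HasStrongDirDeriv g D') :
    HasStrongDirDeriv (fun x => (f x, g x)) fun y h => (D y h, D' y h) where
  locallyLipschitz := hf.locallyLipschitz.prodMk hg.locallyLipschitz
  tendsto y h := (hf.tendsto y h).prodMk_nhds (hg.tendsto y h)
  isBigO_dirDeriv x := (hf.isBigO_dirDeriv x).prod_left (hg.isBigO_dirDeriv x)
  isBigO_sub x := (hf.isBigO_sub x).prod_left (hg.isBigO_sub x)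

end HasStrongDirDeriv

lemma _root_.ContDiffAt.isBigO_fderiv_apply_sub {f : E → F} {x : E} (hf : ContDiffAt ℝ 2 f x) :
    (fun y => fderiv ℝ f y (y - x) - fderiv ℝ f x (y - x)) =O[𝓝 x] fun y => ‖y - x‖ ^ 2 := by
  obtain ⟨K, s, hs, hK⟩ :=
    (hf.fderiv_right (m := 1) (by norm_num)).exists_lipschitzOnWith
  refine IsBigO.of_bound K ?_
  filter_upwards [hs] with y hy
  rw [← _root_.sub_apply, Real.norm_of_nonneg (by positivity), sq, ← mul_assoc]
  exact (ContinuousLinearMap.le_opNorm _ _).trans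
    (mul_le_mul_of_nonneg_right (hK.norm_sub_le hy (mem_of_mem_nhds hs)) (norm_nonneg _))

lemma _root_.ContDiffAt.isBigO_sub_sub_fderiv {f : E → F} {x : E} (hf : ContDiffAt ℝ 2 f x) :
    (fun y => f y - f x - fderiv ℝ f x (y - x)) =O[𝓝 x] fun y => ‖y - x‖ ^ 2 := by
  obtain ⟨K, s, hs, hK⟩ :=
    (hf.fderiv_right (m := 1) (by norm_num)).exists_lipschitzOnWith
  have hd : ∀ᶠ y in 𝓝 x, DifferentiableAt ℝ f y :=
    (hf.eventually (by simp)).mono fun y hy => hy.differentiableAt (by norm_num)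
  obtain ⟨r, hr, hrs⟩ := Metric.mem_nhds_iff.1 (inter_mem hs hd)
  refine IsBigO.of_bound K ?_
  filter_upwards [Metric.ball_mem_nhds x hr] with y hy
  have hsub : Metric.closedBall x (dist y x) ⊆ Metric.ball x r :=
    Metric.closedBall_subset_ball hy
  have := (convex_closedBall x (dist y x)).norm_image_sub_le_of_norm_fderiv_le'
    (f := f) (𝕜 := ℝ) (φ := fderiv ℝ f x) (C := K * dist y x)
    (fun z hz => (hrs (hsub hz)).2)
    (fun z hz => ((hK.norm_sub_le (hrs (hsub hz)).1 (mem_of_mem_nhds hs)).trans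
      (mul_le_mul_of_nonneg_left (by simpa [dist_eq_norm] using hz) K.2)))
    (Metric.mem_closedBall_self dist_nonneg) (Metric.mem_closedBall.2 le_rfl)
  rw [Real.norm_of_nonneg (by positivity), sq, ← mul_assoc, ← dist_eq_norm y x]
  simpa [dist_eq_norm] using this

lemma _root_.ContDiff.hasStrongDirDeriv {f : E → F} (hf : ContDiff ℝ 2 f) :
    HasStrongDirDeriv f fun y => fderiv ℝ f y where
  locallyLipschitz := (hf.of_le (by norm_num)).locallyLipschitz
  tendsto y h := tendsto_slope_of_differentiableAt (hf.differentiable (by norm_num) y) h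
  isBigO_dirDeriv _ := hf.contDiffAt.isBigO_fderiv_apply_sub
  isBigO_sub _ := hf.contDiffAt.isBigO_sub_sub_fderiv

open Classical in
/-- A positively homogeneous function that is `C²` away from the origin. At the origin both error
terms vanish: by Euler's identity, the derivative at `y` along `y` is `f y`. -/
lemma hasStrongDirDeriv_of_homogeneous {f : E → F} (hf : LocallyLipschitz f)
    (hom : ∀ (c : ℝ) (x : E), 0 ≤ c → f (c • x) = c • f x)
    (hd : ∀ x ≠ 0, ContDiffAt ℝ 2 f x) :
    HasStrongDirDeriv f fun y h => if y = 0 then f h else fderiv ℝ f y h := by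
  have f0 : f 0 = 0 := by simpa using hom 0 0 le_rfl
  have euler (y : E) (hy : y ≠ 0) : fderiv ℝ f y y = f y := by
    have h1 := tendsto_slope_of_differentiableAt ((hd y hy).differentiableAt (by norm_num)) y
    refine tendsto_nhds_unique h1 (tendsto_const_nhds.congr' ?_)
    filter_upwards [self_mem_nhdsWithin] with t ht
    have ht : 0 < t := ht
    have : y + t • y = (1 + t) • y := by rw [add_smul, one_smul]
    rw [this, hom _ _ (by positivity), add_smul, one_smul, add_sub_cancel_left, smul_smul,
      inv_mul_cancel₀ ht.ne', one_smul]
  refine ⟨hf, fun y h => ?_, fun x => ?_, fun x => ?_⟩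
  · by_cases hy : y = 0
    · subst hy
      rw [if_pos rfl]
      refine tendsto_const_nhds.congr' ?_
      filter_upwards [self_mem_nhdsWithin] with t ht
      have ht : 0 < t := ht
      rw [zero_add, f0, sub_zero, hom _ _ ht.le, smul_smul, inv_mul_cancel₀ ht.ne', one_smul]
    · rw [if_neg hy]
      exact tendsto_slope_of_differentiableAt ((hd y hy).differentiableAt (by norm_num)) h
  · by_cases hx : x = 0
    · subst hx
      refine (isBigO_zero _ _).congr_left fun y => ?_
      by_cases hy : y = 0 <;> simp [hy, euler]
    · refine (hd x hx).isBigO_fderiv_apply_sub.congr' ?_ EventuallyEq.rfl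
      filter_upwards [isOpen_ne.mem_nhds hx] with y hy
      rw [if_neg hx, if_neg hy]
  · by_cases hx : x = 0
    · subst hx
      refine (isBigO_zero _ _).congr_left fun y => ?_
      simp [f0]
    · simpa only [if_neg hx] using (hd x hx).isBigO_sub_sub_fderiv

/-- `f` has strong directional derivatives, for some choice of the derivative. -/
def StrongDirDifferentiable (f : E → F) : Prop := ∃ D, HasStrongDirDeriv f D

namespace StrongDirDifferentiable

lemma comp {f : F → G} {g : E → F} (hf : StrongDirDifferentiable f)
    (hg : StrongDirDifferentiable g) : StrongDirDifferentiable fun x => f (g x) :=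
  let ⟨_, hf⟩ := hf
  let ⟨_, hg⟩ := hg
  ⟨_, hf.comp hg⟩

lemma prodMk {f : E → F} {g : E → G} (hf : StrongDirDifferentiable f)
    (hg : StrongDirDifferentiable g) : StrongDirDifferentiable fun x => (f x, g x) :=
  let ⟨_, hf⟩ := hf
  let ⟨_, hg⟩ := hg
  ⟨_, hf.prodMk hg⟩

lemma of_contDiff {f : E → F} (hf : ContDiff ℝ 2 f) : StrongDirDifferentiable f :=
  ⟨_, hf.hasStrongDirDeriv⟩

lemma add {f g : E → F} (hf : StrongDirDifferentiable f) (hg : StrongDirDifferentiable g) :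
    StrongDirDifferentiable fun x => f x + g x :=
  (of_contDiff (contDiff_fst.add contDiff_snd)).comp (hf.prodMk hg)

lemma sub {f g : E → F} (hf : StrongDirDifferentiable f) (hg : StrongDirDifferentiable g) :
    StrongDirDifferentiable fun x => f x - g x :=
  (of_contDiff (contDiff_fst.sub contDiff_snd)).comp (hf.prodMk hg)

lemma mul {f g : E → ℝ} (hf : StrongDirDifferentiable f) (hg : StrongDirDifferentiable g) :
    StrongDirDifferentiable fun x => f x * g x :=
  (of_contDiff (contDiff_fst.mul contDiff_snd)).comp (hf.prodMk hg)

lemma sum {ι : Type*} {f : ι → E → F} (s : Finset ι) (hf : ∀ i, StrongDirDifferentiable (f i)) :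
    StrongDirDifferentiable fun x => ∑ i ∈ s, f i x := by
  classical
  induction s using Finset.induction_on with
  | empty => simpa using of_contDiff contDiff_const
  | insert i s hi ih => simpa only [Finset.sum_insert hi] using (hf i).add ih

lemma euclidean {ι : Type*} [Fintype ι] {f : E → EuclideanSpace ℝ ι}
    (hf : ∀ i, StrongDirDifferentiable fun x => f x i) : StrongDirDifferentiable f := by
  classical
  have h1 : StrongDirDifferentiable fun x => ∑ i, f x i • EuclideanSpace.single i (1 : ℝ) :=
    sum _ fun i => (of_contDiff (f := fun r : ℝ => r • EuclideanSpace.single i (1 : ℝ))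
      (by fun_prop)).comp (hf i)
  convert h1 using 2 with x
  ext j
  simp [Pi.single_apply]

end StrongDirDifferentiable

lemma strongDirDifferentiable_posPart : StrongDirDifferentiable fun a : ℝ => max a 0 := by
  refine ⟨_, hasStrongDirDeriv_of_homogeneous ?_ (fun c a hc => ?_) fun a ha => ?_⟩
  · exact (LipschitzWith.id.max_const 0).locallyLipschitz
  · simp only [smul_eq_mul, mul_max_of_nonneg _ _ hc, mul_zero]
  · rcases ha.lt_or_gt with ha | ha
    · refine (contDiffAt_const (c := (0 : ℝ))).congr_of_eventuallyEq ?_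
      filter_upwards [Iio_mem_nhds ha] with b hb using max_eq_right (le_of_lt hb)
    · refine contDiffAt_id.congr_of_eventuallyEq ?_
      filter_upwards [Ioi_mem_nhds ha] with b hb using max_eq_left (le_of_lt hb)

lemma strongDirDifferentiable_norm {E : Type*} [NormedAddCommGroup E] [InnerProductSpace ℝ E] :
    StrongDirDifferentiable fun a : E => ‖a‖ :=
  ⟨_, hasStrongDirDeriv_of_homogeneous lipschitzWith_one_norm.locallyLipschitz
    (fun c a hc => by rw [norm_smul, Real.norm_of_nonneg hc, smul_eq_mul])
    fun _ ha => contDiffAt_norm ℝ ha⟩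

end Calculus

/-! ### From directional derivatives to the generalized Jacobian -/

lemma mulVec_jacobian {p q : ℕ} (F : Vec p → Vec q) (y d : Vec p) :
    mulVec (jacobian F y) d = fderiv ℝ F y d := by
  have hd : d = ∑ j, d j • EuclideanSpace.single j (1 : ℝ) := by
    ext j
    simp [Pi.single_apply]
  conv_rhs => rw [hd]
  ext i
  simp [mulVec, jacobian, Matrix.mulVec, dotProduct, mul_comm]

lemma tendsto_mulVec {α : Type*} {l : Filter α} {p q : ℕ}
    {W : α → Matrix (Fin q) (Fin p) ℝ} {V : Matrix (Fin q) (Fin p) ℝ} {v : α → Vec p} {d : Vec p}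
    (hW : Tendsto W l (𝓝 V)) (hv : Tendsto v l (𝓝 d)) :
    Tendsto (fun a => mulVec (W a) (v a)) l (𝓝 (mulVec V d)) := by
  refine ((PiLp.continuous_toLp 2 _).tendsto _).comp (tendsto_pi_nhds.2 fun i => ?_)
  simp only [Matrix.mulVec, dotProduct]
  refine tendsto_finsetSum _ fun j _ => ?_
  exact (tendsto_pi_nhds.1 (tendsto_pi_nhds.1 hW i) j).mul
    (((EuclideanSpace.proj j : Vec p →L[ℝ] ℝ).continuous.tendsto d).comp hv)

lemma isLinearMap_mulVec {p q : ℕ} (d : Vec p) :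
    IsLinearMap ℝ fun W : Matrix (Fin q) (Fin p) ℝ => mulVec W d where
  map_add W W' := by simp only [mulVec, Matrix.add_mulVec, WithLp.toLp_add]
  map_smul c W := by simp only [mulVec, Matrix.smul_mulVec, WithLp.toLp_smul]

/-- A bound on the Jacobians at points of differentiability passes to their limits. -/
lemma norm_mulVec_sub_le_of_mem_bSubdifferential {p q : ℕ} {F : Vec p → Vec q} {x d : Vec p}
    {D : Vec p → Vec q} (hD : Continuous D) {C : ℝ}
    (h : ∀ᶠ y in 𝓝 (x + d), DifferentiableAt ℝ F y →
      ‖fderiv ℝ F y (y - x) - D (y - x)‖ ≤ C * ‖y - x‖ ^ 2)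
    {V : Matrix (Fin q) (Fin p) ℝ} (hV : V ∈ bSubdifferential F (x + d)) :
    ‖mulVec V d - D d‖ ≤ C * ‖d‖ ^ 2 := by
  obtain ⟨u, hu, hux, huV⟩ := hV
  have hsub : Tendsto (fun k => u k - x) atTop (𝓝 d) := by simpa using hux.sub_const x
  have h1 : Tendsto (fun k => mulVec (jacobian F (u k)) (u k - x)) atTop (𝓝 (mulVec V d)) :=
    tendsto_mulVec huV hsub
  have h2 : Tendsto (fun k => ‖mulVec (jacobian F (u k)) (u k - x) - D (u k - x)‖) atTop
      (𝓝 ‖mulVec V d - D d‖) := (h1.sub ((hD.tendsto d).comp hsub)).norm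
  have h3 : Tendsto (fun k => C * ‖u k - x‖ ^ 2) atTop (𝓝 (C * ‖d‖ ^ 2)) :=
    (hsub.norm.pow 2).const_mul C
  refine le_of_tendsto_of_tendsto h2 h3 ?_
  filter_upwards [hux.eventually h] with k hk
  rw [mulVec_jacobian]
  exact hk (hu k)

lemma norm_mulVec_sub_le {p q : ℕ} {F : Vec p → Vec q} {x d : Vec p} {D : Vec p → Vec q}
    (hD : Continuous D) {C : ℝ}
    (h : ∀ᶠ y in 𝓝 (x + d), DifferentiableAt ℝ F y →
      ‖fderiv ℝ F y (y - x) - D (y - x)‖ ≤ C * ‖y - x‖ ^ 2)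
    {V : Matrix (Fin q) (Fin p) ℝ} (hV : V ∈ generalizedJacobian F (x + d)) :
    ‖mulVec V d - D d‖ ≤ C * ‖d‖ ^ 2 := by
  have hconv : Convex ℝ {W : Matrix (Fin q) (Fin p) ℝ | ‖mulVec W d - D d‖ ≤ C * ‖d‖ ^ 2} := by
    simpa only [Set.preimage, Metric.mem_closedBall, dist_eq_norm] using
      (convex_closedBall (D d) (C * ‖d‖ ^ 2)).is_linear_preimage (isLinearMap_mulVec (q := q) d)
  have hsub : bSubdifferential F (x + d) ⊆
      {W : Matrix (Fin q) (Fin p) ℝ | ‖mulVec W d - D d‖ ≤ C * ‖d‖ ^ 2} := fun W hW =>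
    norm_mulVec_sub_le_of_mem_bSubdifferential hD h hW
  exact convexHull_min hsub hconv hV

lemma StrongDirDifferentiable.stronglySemismooth {p q : ℕ} {F : Vec p → Vec q}
    (hF : StrongDirDifferentiable F) : StronglySemismooth F := by
  obtain ⟨D, hF⟩ := hF
  have key (x : Vec p) : ∃ C : ℝ, ∀ᶠ d in 𝓝 (0 : Vec p), ∀ V ∈ generalizedJacobian F (x + d),
      ‖mulVec V d - D x d‖ ≤ C * ‖d‖ ^ 2 := by
    obtain ⟨C, hC⟩ := (hF.isBigO_dirDeriv x).bound
    refine ⟨C, ?_⟩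
    have hx : Tendsto (fun d : Vec p => x + d) (𝓝 0) (𝓝 x) := by
      simpa using (tendsto_const_nhds (x := x)).add (tendsto_id (x := 𝓝 (0 : Vec p)))
    filter_upwards [hx.eventually (eventually_eventually_nhds.2 hC)] with d hd V hV
    refine norm_mulVec_sub_le (hF.continuous x) (hd.mono fun y hy hdy => ?_) hV
    rw [← hF.eq_fderiv hdy]
    simpa using hy
  refine ⟨fun x => ⟨hF.locallyLipschitz x, fun d => ⟨D x d, fun ε hε => ?_⟩⟩,
    fun x => ⟨D x, hF.tendsto x, key x⟩⟩
  obtain ⟨C, hC⟩ := key x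
  have hfst : Tendsto Prod.fst (𝓝 d ×ˢ 𝓝[>] (0 : ℝ)) (𝓝 d) := tendsto_fst
  have hsnd : Tendsto Prod.snd (𝓝 d ×ˢ 𝓝[>] (0 : ℝ)) (𝓝 0) :=
    tendsto_snd.mono_right nhdsWithin_le_nhds
  have hpos : ∀ᶠ w : Vec p × ℝ in 𝓝 d ×ˢ 𝓝[>] (0 : ℝ), 0 < w.2 :=
    tendsto_snd.eventually (self_mem_nhdsWithin (s := Set.Ioi (0 : ℝ)) (a := 0))
  have hsmul : Tendsto (fun w : Vec p × ℝ => w.2 • w.1) (𝓝 d ×ˢ 𝓝[>] (0 : ℝ)) (𝓝 0) := by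
    simpa using hsnd.smul hfst
  have hbound : Tendsto (fun w : Vec p × ℝ => w.2 * (C * ‖w.1‖ ^ 2) + ‖D x w.1 - D x d‖)
      (𝓝 d ×ˢ 𝓝[>] (0 : ℝ)) (𝓝 0) := by
    simpa using (hsnd.mul ((hfst.norm.pow 2).const_mul C)).add
      ((((hF.continuous x).tendsto d).comp hfst).sub_const (D x d)).norm
  filter_upwards [hsmul.eventually hC, hpos, hbound.eventually_lt_const hε] with w hw ht hlt V hV
  have h1 := hw V hV
  have h2 : mulVec V (w.2 • w.1) = w.2 • mulVec V w.1 := by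
    simp [mulVec, Matrix.mulVec_smul]
  rw [h2, hF.dirDeriv_smul x _ ht, ← smul_sub, norm_smul, norm_smul, Real.norm_of_nonneg ht.le]
    at h1
  have h3 : ‖mulVec V w.1 - D x w.1‖ ≤ w.2 * (C * ‖w.1‖ ^ 2) := by
    refine le_of_mul_le_mul_left (h1.trans_eq ?_) ht
    ring
  calc ‖mulVec V w.1 - D x d‖
      ≤ ‖mulVec V w.1 - D x w.1‖ + ‖D x w.1 - D x d‖ := norm_sub_le_norm_sub_add_norm_sub _ _ _
    _ < ε := lt_of_le_of_lt (by gcongr) hlt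

/-! ### Strong semismoothness of the reformulations -/

lemma strongDirDifferentiable_phiMin :
    StrongDirDifferentiable fun w : ℝ × ℝ => phiMin w.1 w.2 :=
  (StrongDirDifferentiable.of_contDiff contDiff_fst).sub
    (strongDirDifferentiable_posPart.comp
      (StrongDirDifferentiable.of_contDiff (contDiff_fst.sub contDiff_snd)))

lemma strongDirDifferentiable_phiFB :
    StrongDirDifferentiable fun w : ℝ × ℝ => phiFB w.1 w.2 := by
  have h : StrongDirDifferentiable fun w : ℝ × ℝ => ‖!₂[w.1, w.2]‖ :=
    strongDirDifferentiable_norm.comp <| .euclidean fun i => by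
      fin_cases i
      · exact .of_contDiff contDiff_fst
      · exact .of_contDiff contDiff_snd
  simpa [phiFB, EuclideanSpace.norm_eq] using
    (StrongDirDifferentiable.of_contDiff (contDiff_fst.add contDiff_snd)).sub h

lemma strongDirDifferentiable_phiTau (τ : ℝ) :
    StrongDirDifferentiable fun w : ℝ × ℝ => phiTau τ w.1 w.2 :=
  ((StrongDirDifferentiable.of_contDiff contDiff_const).mul strongDirDifferentiable_phiFB).add
    ((StrongDirDifferentiable.of_contDiff contDiff_const).mul
      ((strongDirDifferentiable_posPart.comp (.of_contDiff contDiff_fst)).mul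
        (strongDirDifferentiable_posPart.comp (.of_contDiff contDiff_snd))))

lemma contDiff_xPart {n : ℕ} (i : Fin n) : ContDiff ℝ 2 fun z : Vec (n + 1) => xPart z i := by
  unfold xPart
  fun_prop

lemma contDiff_mapF {k n : ℕ} (A B : Tensor (k + 1) n) (i : Fin n) :
    ContDiff ℝ 2 fun z : Vec (n + 1) => mapF A B (xPart z) (tPart z) i := by
  simp only [mapF, Tensor.applyVec, tPart, xPart, Pi.sub_apply, Pi.smul_apply, smul_eq_mul]
  refine ContDiff.sum fun j _ => ContDiff.mul (by fun_prop) (contDiff_prod fun l _ => by fun_prop)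

lemma contDiff_normSq {n : ℕ} :
    ContDiff ℝ 2 fun z : Vec (n + 1) => xPart z ⬝ᵥ xPart z - 1 := by
  simp only [dotProduct, xPart]
  fun_prop

lemma stronglySemismooth_mapH {k n : ℕ} {φ : ℝ → ℝ → ℝ}
    (hφ : StrongDirDifferentiable fun w : ℝ × ℝ => φ w.1 w.2) (A B : Tensor (k + 1) n) :
    StronglySemismooth (mapH φ A B) := by
  refine (StrongDirDifferentiable.euclidean fun i => ?_).stronglySemismooth
  induction i using Fin.lastCases with
  | last => simpa [mapH] using StrongDirDifferentiable.of_contDiff contDiff_normSq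
  | cast i =>
    simpa [mapH, mapPhi] using hφ.comp
      (.of_contDiff ((contDiff_xPart i).prodMk (contDiff_mapF A B i)))

/-! ### The generalized Jacobian of the bordered map -/

section Inclusion

variable {k n : ℕ} (φ : ℝ → ℝ → ℝ) (A B : Tensor (k + 1) n)

lemma differentiableAt_mapPhi {z : Vec (n + 1)} (h : DifferentiableAt ℝ (mapH φ A B) z) :
    DifferentiableAt ℝ (mapPhi φ A B) z := by
  rw [differentiableAt_euclidean] at h ⊢
  exact fun i => by simpa [mapH] using h i.castSucc

lemma fderiv_euclidean_apply {p q : ℕ} {F : Vec p → Vec q} {z : Vec p}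
    (h : DifferentiableAt ℝ F z) (d : Vec p) (i : Fin q) :
    fderiv ℝ F z d i = fderiv ℝ (fun y => F y i) z d := by
  have h1 : HasFDerivAt (fun y => F y i) _ z :=
    (EuclideanSpace.proj i : Vec q →L[ℝ] ℝ).hasFDerivAt.comp z h.hasFDerivAt
  rw [h1.fderiv]
  rfl

lemma fderiv_normSq (z d : Vec (n + 1)) :
    fderiv ℝ (fun y : Vec (n + 1) => xPart y ⬝ᵥ xPart y - 1) z d = 2 * (xPart z ⬝ᵥ xPart d) := by
  have h1 (i : Fin n) : HasFDerivAt (fun y : Vec (n + 1) => xPart y i)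
      (EuclideanSpace.proj i.castSucc : Vec (n + 1) →L[ℝ] ℝ) z :=
    (EuclideanSpace.proj i.castSucc : Vec (n + 1) →L[ℝ] ℝ).hasFDerivAt
  have h2 : HasFDerivAt (fun y : Vec (n + 1) => xPart y ⬝ᵥ xPart y - 1) _ z :=
    (HasFDerivAt.fun_sum fun i (_ : i ∈ Finset.univ) => (h1 i).mul (h1 i)).sub_const 1
  rw [h2.fderiv]
  simp [dotProduct, Finset.mul_sum, xPart, two_mul]

lemma jacobian_mapH {z : Vec (n + 1)} (h : DifferentiableAt ℝ (mapH φ A B) z) :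
    jacobian (mapH φ A B) z = bordered (jacobian (mapPhi φ A B) z) (xPart z) := by
  ext i j
  induction i using Fin.lastCases with
  | last =>
    rw [jacobian, Matrix.of_apply, fderiv_euclidean_apply h]
    have : (fun y => mapH φ A B y (Fin.last n)) = fun y => xPart y ⬝ᵥ xPart y - 1 := by
      ext y
      simp [mapH]
    rw [this, fderiv_normSq]
    induction j using Fin.lastCases with
    | last => simp [bordered, dotProduct, xPart, (Fin.castSucc_lt_last _).ne]
    | cast j => simp [bordered, dotProduct, xPart, PiLp.single_apply]
  | cast i =>
    rw [jacobian, Matrix.of_apply, fderiv_euclidean_apply h]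
    simp only [bordered, Matrix.of_apply, Fin.snoc_castSucc, jacobian]
    rw [fderiv_euclidean_apply (differentiableAt_mapPhi φ A B h)]
    simp [mapH]

lemma convex_bordered {s : Set (Matrix (Fin n) (Fin (n + 1)) ℝ)} (hs : Convex ℝ s)
    (x : Fin n → ℝ) : Convex ℝ {M | ∃ V ∈ s, M = bordered V x} := by
  rintro _ ⟨V, hV, rfl⟩ _ ⟨W, hW, rfl⟩ a b ha hb hab
  refine ⟨a • V + b • W, hs hV hW ha hb hab, ?_⟩
  ext i j
  induction i using Fin.lastCases with
  | last =>
    simp only [bordered, Matrix.add_apply, Matrix.smul_apply, Matrix.of_apply, Fin.snoc_last,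
      smul_eq_mul]
    rw [← add_mul, hab, one_mul]
  | cast i => simp [bordered]

theorem generalizedJacobian_mapH_subset (z : Vec (n + 1)) :
    generalizedJacobian (mapH φ A B) z ⊆
      {M | ∃ V ∈ generalizedJacobian (mapPhi φ A B) z, M = bordered V (xPart z)} := by
  refine convexHull_min ?_ (convex_bordered (convex_convexHull ℝ _) _)
  rintro M ⟨u, hu, huz, huM⟩
  have hJ (l : ℕ) := jacobian_mapH φ A B (hu l)
  have hrow (i : Fin n) : Tendsto (fun l => jacobian (mapPhi φ A B) (u l) i) atTop
      (𝓝 (M i.castSucc)) := by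
    refine ((tendsto_pi_nhds.1 huM) i.castSucc).congr fun l => ?_
    ext j
    simp [hJ, bordered]
  refine ⟨fun i => M i.castSucc, subset_convexHull ℝ _ ⟨u, fun l =>
    differentiableAt_mapPhi φ A B (hu l), huz, tendsto_pi_nhds.2 hrow⟩, ?_⟩
  ext i j
  induction i using Fin.lastCases with
  | cast i => simp [bordered]
  | last =>
    have h1 : Tendsto (fun l => jacobian (mapH φ A B) (u l) (Fin.last n) j) atTop
        (𝓝 (M (Fin.last n) j)) := (tendsto_pi_nhds.1 ((tendsto_pi_nhds.1 huM) _)) j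
    refine tendsto_nhds_unique h1 ?_
    simp only [hJ, bordered, Matrix.of_apply, Fin.snoc_last]
    induction j using Fin.lastCases with
    | last => simp
    | cast j =>
      simp only [Fin.snoc_castSucc]
      have hc : Continuous fun y : Vec (n + 1) => 2 * xPart y j :=
        continuous_const.mul (contDiff_xPart j).continuous
      exact (hc.tendsto z).comp huz

end Inclusion

end TEiCP

theorem theorem1 {k n : ℕ} (hm : Even (k + 1)) (A B : TEiCP.Tensor (k + 1) n)
    (hB : B.IsPosDef) :
    -- strong semismoothness of the three maps
    TEiCP.StronglySemismooth (TEiCP.mapH TEiCP.phiMin A B) ∧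
    TEiCP.StronglySemismooth (TEiCP.mapH TEiCP.phiFB A B) ∧
    (∀ τ ∈ Set.Ioo (0 : ℝ) 1, TEiCP.StronglySemismooth (TEiCP.mapH (TEiCP.phiTau τ) A B)) ∧
    -- the inclusion for the generalized Jacobian of the three maps
    (∀ φ : ℝ → ℝ → ℝ,
      (φ = TEiCP.phiMin ∨ φ = TEiCP.phiFB ∨ ∃ τ ∈ Set.Ioo (0 : ℝ) 1, φ = TEiCP.phiTau τ) →
      ∀ z : TEiCP.Vec (n + 1),
        TEiCP.generalizedJacobian (TEiCP.mapH φ A B) z ⊆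
          {M | ∃ V ∈ TEiCP.generalizedJacobian (TEiCP.mapPhi φ A B) z,
            M = TEiCP.bordered V (TEiCP.xPart z)}) ∧
    -- the same inclusion for every other locally Lipschitz NCP-function
    (∀ φ : ℝ → ℝ → ℝ, TEiCP.IsNCPFunction φ →
      LocallyLipschitz (fun p : ℝ × ℝ => φ p.1 p.2) →
      ∀ z : TEiCP.Vec (n + 1),
        TEiCP.generalizedJacobian (TEiCP.mapH φ A B) z ⊆
          {M | ∃ V ∈ TEiCP.generalizedJacobian (TEiCP.mapPhi φ A B) z,
            M = TEiCP.bordered V (TEiCP.xPart z)}) := by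
  exact ⟨TEiCP.stronglySemismooth_mapH TEiCP.strongDirDifferentiable_phiMin A B,
    TEiCP.stronglySemismooth_mapH TEiCP.strongDirDifferentiable_phiFB A B,
    fun τ _ => TEiCP.stronglySemismooth_mapH (TEiCP.strongDirDifferentiable_phiTau τ) A B,
    fun φ _ => TEiCP.generalizedJacobian_mapH_subset φ A B,
    fun φ _ _ => TEiCP.generalizedJacobian_mapH_subset φ A B⟩
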